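/- Let $W(y|x)$, $x\in\mathcal X$, $y\in\mathcal Y$, be the transition law of a discrete memoryless channel with finite nonempty input alphabet $\mathcal X$ and finite output alphabet $\mathcal Y$, and let $\rho>0$. For $R\in\mathbb R$ and $n\ge 1$ put $M_n=\lfloor e^{nR}\rfloor$. A blocklength-$n$ rate-$R$ encoder (without feedback) is a mapping $f\colon\{1,\dots,M_n\}\to\mathcal X^n$; a blocklength-$n$ rate-$R$ feedback encoder is an $n$-tuple $f=(f^{(1)},\dots,f^{(n)})$ of mappings $f^{(i)}\colon\{1,\dots,M_n\}\times\mathcal Y^{i-1}\to\mathcal X$. When message $m$ is sent, the probability of the output $\mathbf y=(y_1,\dots,y_n)\in\mathcal Y^n$ is $$p_f(\mathbf y|m)=\prod_{i=1}^n W\bigl(y_i\big|f(m)_i\bigr)\quad\text{without feedback},\qquad p_f(\mathbf y|m)=\prod_{i=1}^n W\bigl(y_i\big|f^{(i)}(m,y_1,\dots,y_{i-1})\bigr)\quad\text{with feedback}.$$ Let $\mathcal L_f(m,\mathbf y)=\{\tilde m: p_f(\mathbf y|\tilde m)\ge p_f(\mathbf y|m)\}$ be the list of messages that are at least as likely as $m$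 given $\mathbf y$. The cutoff rate $C_{\mathrm{cutoff}}(\rho)$ is the supremum of all rates $R$ for which there is a sequence $(f_n)_{n\ge1}$ of blocklength-$n$ rate-$R$ encoders with $$\lim_{n\to\infty}\frac1{M_n}\sum_{m=1}^{M_n}\sum_{\mathbf y\in\mathcal Y^n}p_{f_n}(\mathbf y|m)\,|\mathcal L_{f_n}(m,\mathbf y)|^\rho=1$$ (the average being read as $0$ when $M_n=0$), and the cutoff rate with feedback $C_{\mathrm{cutoff,fb}}(\rho)$ is defined in the same way with feedback encoders. Then both suprema are taken over nonempty sets of rates that are bounded above (so both are real numbers), and feedback does not increase the cutoff rate: $$C_{\mathrm{cutoff,fb}}(\rho)=C_{\mathrm{cutoff}}(\rho).$$ -/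

import Mathlib

/-- A discrete memoryless channel with input alphabet `X` and finite output alphabet `Y`:
`W.law x y` is the transition probability `W(y|x)`. -/
structure DMC (X Y : Type*) [Fintype Y] where
  law : X → Y → ℝ
  law_nonneg : ∀ x y, 0 ≤ law x y
  law_sum : ∀ x, ∑ y, law x y = 1

namespace DMC

noncomputable section

/-- The number of messages of a blocklength-`n` rate-`R` code, the integer part of `e^{nR}`. -/
def numMessages (n : ℕ) (R : ℝ) : ℕ := ⌊Real.exp (n * R)⌋₊

/-- An encoder without feedback: every message is mapped to a codeword in `X^n`. -/
abbrev Encoder (X : Type*) (n M : ℕ) := Fin M → Fin n → X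

/-- An encoder with feedback: the channel input at time `i` (counted from `0`) is a function of the
message and of the `i` preceding channel outputs. -/
abbrev FeedbackEncoder (X Y : Type*) (n M : ℕ) := (i : Fin n) → Fin M → (Fin (i : ℕ) → Y) → X

/-- The first `i` components of the `n`-tuple `y`. -/
def past {Y : Type*} {n : ℕ} (y : Fin n → Y) (i : Fin n) : Fin (i : ℕ) → Y :=
  fun j => y (Fin.castLE i.isLt.le j)

variable {X Y : Type*} [Fintype Y]

/-- The probability of the output `y` when message `m` is sent without feedback. -/
def likelihood (W : DMC X Y) {n M : ℕ} (f : Encoder X n M) (m : Fin M) (y : Fin n → Y) : ℝ :=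
  ∏ i, W.law (f m i) (y i)

/-- The probability of the output `y` when message `m` is sent with feedback. -/
def feedbackLikelihood (W : DMC X Y) {n M : ℕ} (f : FeedbackEncoder X Y n M) (m : Fin M)
    (y : Fin n → Y) : ℝ :=
  ∏ i, W.law (f i m (past y i)) (y i)

/-- Given the law `p m` of the output for each message `m`, the list of all messages that are at
least as likely as `m` when `y` is observed. -/
def likelyList {n M : ℕ} (p : Fin M → (Fin n → Y) → ℝ) (m : Fin M) (y : Fin n → Y) :
    Finset (Fin M) :=
  Finset.univ.filter fun m' => p m y ≤ p m' y

/-- The `ρ`-th moment of the length of the list `likelyList`, for a uniformly distributed message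
and the output law `p`. -/
def listMoment (ρ : ℝ) {n M : ℕ} (p : Fin M → (Fin n → Y) → ℝ) : ℝ :=
  (M : ℝ)⁻¹ * ∑ m, ∑ y, p m y * ((likelyList p m y).card : ℝ) ^ ρ

/-- The rates `R` for which some sequence of blocklength-`n` rate-`R` encoders makes the `ρ`-th
moment of the length of the list tend to one. -/
def cutoffAchievable (W : DMC X Y) (ρ : ℝ) : Set ℝ :=
  {R | ∃ f : (n : ℕ) → Encoder X n (numMessages n R),
    Filter.Tendsto (fun n => listMoment ρ (W.likelihood (f n))) Filter.atTop (nhds 1)}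

/-- The rates achievable in the same sense with feedback encoders. -/
def cutoffAchievableFeedback (W : DMC X Y) (ρ : ℝ) : Set ℝ :=
  {R | ∃ f : (n : ℕ) → FeedbackEncoder X Y n (numMessages n R),
    Filter.Tendsto (fun n => listMoment ρ (W.feedbackLikelihood (f n))) Filter.atTop (nhds 1)}

/-- The cutoff rate. -/
def cutoffRate (W : DMC X Y) (ρ : ℝ) : ℝ := sSup (W.cutoffAchievable ρ)

/-- The cutoff rate with feedback. -/
def cutoffRateFeedback (W : DMC X Y) (ρ : ℝ) : ℝ := sSup (W.cutoffAchievableFeedback ρ)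

end

end DMC

/-! Both suprema equal `C`, where `exp (-ρC)` is the minimum `γ` over input laws `P` of `∑ y, (∑ x,
P x * W(y|x)^(1/(1+ρ)))^(1+ρ)`.

Converse, with feedback: Arıkan's inequality (`Real.rpow_one_add_sum_rpow_le`) bounds the list
moment below by `∑ y, (∑ m, p(y|m)^(1/(1+ρ)))^(1+ρ)`, up to the factor `1/M` and a power of `1 + log
M`. Let `g` be the inner sum at the minimizer. Optimality gives `γ ≤ ∑ y, W(y|x)^(1/(1+ρ)) * g y ^
ρ` for every input `x`. As this holds for every input, it does not matter that feedback picks the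
input from the past: summing out one output at a time gives `γ^n`. Hölder against `∏ g (y i)` then
shows that the moment is at least `M^ρ γ^n / (1 + log M)^ρ`, which diverges when `R > C`.

Achievability, without feedback: for i.i.d. codewords with letters drawn from the same `P`, the list
length is one plus a binomial variable. Its `ρ`-th moment exceeds one by little when the binomial
mean is small, and Gallager's bound makes that mean small when `R < C`. -/

/-! ### Hölder's inequality and moments of list sizes -/

open Finset in
-- Without ties the list sizes are 1, 2, ..., and equality holds; ties only enlarge the lists.
-- Removing a minimal element, whose list is all of `s`, accounts for the last harmonic term.
theorem Finset.sum_inv_card_filter_le_harmonic {ι : Type*} (v : ι → ℝ) (s : Finset ι) :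
    ∑ m ∈ s, ((s.filter fun m' => v m ≤ v m').card : ℝ)⁻¹ ≤ (harmonic s.card : ℝ) := by
  classical
  induction s using Finset.induction_on_min_value v with
  | empty => simp
  | insert a s ha hmin ih =>
    rw [sum_insert ha, card_insert_of_notMem ha, harmonic_succ, add_comm]
    push_cast
    refine add_le_add (le_trans (sum_le_sum fun m hm => ?_) ih) (le_of_eq ?_)
    · apply inv_anti₀
      · exact_mod_cast card_pos.2 ⟨m, by simp [hm]⟩
      · exact_mod_cast card_le_card (filter_subset_filter _ (subset_insert a s))
    · have : (insert a s).filter (fun m' => v a ≤ v m') = insert a s := by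
        apply filter_true_of_mem
        intro x hx
        rcases mem_insert.1 hx with rfl | hx
        · exact le_rfl
        · exact hmin x hx
      rw [this, card_insert_of_notMem ha]
      push_cast
      rfl

/-- Hölder with the conjugate exponents `1 + ρ` and `(1 + ρ)/ρ`, raised to the power `1 + ρ`. -/
theorem Real.rpow_one_add_sum_mul_rpow_le {ι : Type*} (s : Finset ι) {ρ : ℝ} (hρ : 0 < ρ)
    {f g : ι → ℝ} (hf : ∀ i, 0 ≤ f i) (hg : ∀ i, 0 ≤ g i) :
    (∑ i ∈ s, f i * g i ^ ρ) ^ (1 + ρ) ≤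
      (∑ i ∈ s, f i ^ (1 + ρ)) * (∑ i ∈ s, g i ^ (1 + ρ)) ^ ρ := by
  have hρ' : 0 < 1 + ρ := by linarith
  have hpq : (1 + ρ).HolderConjugate ((1 + ρ) / ρ) := by
    rw [Real.holderConjugate_iff]
    exact ⟨by linarith, by field_simp⟩
  have h := Real.inner_le_Lp_mul_Lq_of_nonneg s hpq (f := f) (g := fun i => g i ^ ρ)
    (fun i _ => hf i) (fun i _ => Real.rpow_nonneg (hg i) _)
  have hF : 0 ≤ ∑ i ∈ s, f i ^ (1 + ρ) :=
    Finset.sum_nonneg fun i _ => Real.rpow_nonneg (hf i) _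
  have hG : 0 ≤ ∑ i ∈ s, g i ^ (1 + ρ) :=
    Finset.sum_nonneg fun i _ => Real.rpow_nonneg (hg i) _
  have hgg : ∀ i, (g i ^ ρ) ^ ((1 + ρ) / ρ) = g i ^ (1 + ρ) := fun i => by
    rw [← Real.rpow_mul (hg i)]
    congr 1
    field_simp
  simp only [hgg] at h
  calc _ ≤ ((∑ i ∈ s, f i ^ (1 + ρ)) ^ (1 / (1 + ρ)) *
          (∑ i ∈ s, g i ^ (1 + ρ)) ^ (1 / ((1 + ρ) / ρ))) ^ (1 + ρ) :=
        Real.rpow_le_rpow (Finset.sum_nonneg fun i _ =>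
          mul_nonneg (hf i) (Real.rpow_nonneg (hg i) _)) h hρ'.le
    _ = _ := by
        rw [Real.mul_rpow (Real.rpow_nonneg hF _) (Real.rpow_nonneg hG _), ← Real.rpow_mul hF,
          ← Real.rpow_mul hG]
        congr 2
        · rw [one_div_mul_cancel hρ'.ne', Real.rpow_one]
        · field_simp

/-- Arıkan's lower bound for the moments of the position of an element in a decreasing list. -/
theorem Real.rpow_one_add_sum_rpow_le {ι : Type*} [Fintype ι] {ρ : ℝ} (hρ : 0 < ρ) {p : ι → ℝ}
    (hp : ∀ i, 0 ≤ p i) :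
    (∑ i, p i ^ (1 / (1 + ρ))) ^ (1 + ρ) ≤
      (1 + Real.log (Fintype.card ι)) ^ ρ *
        ∑ i, p i * ((Finset.univ.filter fun j => p i ≤ p j).card : ℝ) ^ ρ := by
  have hρ' : 0 < 1 + ρ := by linarith
  set L : ι → ℝ := fun i => ((Finset.univ.filter fun j => p i ≤ p j).card : ℝ) with hL
  have hLpos : ∀ i, 0 < L i := fun i => by
    simp only [hL]
    exact_mod_cast Finset.card_pos.2 ⟨i, by simp⟩
  -- The factors are chosen so that the powers of `L` cancel in the product, while the second sum
  -- becomes `∑ 1 / L i`, which is at most harmonic.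
  have h := Real.rpow_one_add_sum_mul_rpow_le Finset.univ hρ
    (f := fun i => (p i * L i ^ ρ) ^ (1 / (1 + ρ))) (g := fun i => (L i)⁻¹ ^ (1 / (1 + ρ)))
    (fun i => Real.rpow_nonneg (mul_nonneg (hp i) (Real.rpow_nonneg (hLpos i).le _)) _)
    (fun i => Real.rpow_nonneg (inv_nonneg.2 (hLpos i).le) _)
  have h1 : ∀ i, (p i * L i ^ ρ) ^ (1 / (1 + ρ)) * ((L i)⁻¹ ^ (1 / (1 + ρ))) ^ ρ =
      p i ^ (1 / (1 + ρ)) := fun i => by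
    rw [← Real.rpow_mul (inv_nonneg.2 (hLpos i).le), mul_comm (1 / (1 + ρ)) ρ,
      Real.rpow_mul (inv_nonneg.2 (hLpos i).le),
      ← Real.mul_rpow (mul_nonneg (hp i) (Real.rpow_nonneg (hLpos i).le _))
        (Real.rpow_nonneg (inv_nonneg.2 (hLpos i).le) _), mul_assoc,
      ← Real.mul_rpow (hLpos i).le (inv_nonneg.2 (hLpos i).le), mul_inv_cancel₀ (hLpos i).ne',
      Real.one_rpow, mul_one]
  have h2 : ∀ i, ((p i * L i ^ ρ) ^ (1 / (1 + ρ))) ^ (1 + ρ) = p i * L i ^ ρ := fun i => by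
    rw [← Real.rpow_mul (mul_nonneg (hp i) (Real.rpow_nonneg (hLpos i).le _)),
      one_div_mul_cancel hρ'.ne', Real.rpow_one]
  have h3 : ∀ i, ((L i)⁻¹ ^ (1 / (1 + ρ))) ^ (1 + ρ) = (L i)⁻¹ := fun i => by
    rw [← Real.rpow_mul (inv_nonneg.2 (hLpos i).le), one_div_mul_cancel hρ'.ne', Real.rpow_one]
  simp only [h1, h2, h3] at h
  refine h.trans ?_
  rw [mul_comm]
  refine mul_le_mul_of_nonneg_right (Real.rpow_le_rpow (Finset.sum_nonneg fun i _ =>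
    inv_nonneg.2 (hLpos i).le) ?_ hρ.le) (Finset.sum_nonneg fun i _ =>
      mul_nonneg (hp i) (Real.rpow_nonneg (hLpos i).le _))
  exact (Finset.sum_inv_card_filter_le_harmonic p Finset.univ).trans
    (harmonic_le_one_add_log _)

/-! ### Optimal input law -/

/-- The optimality condition for the input distribution in Gallager's function. -/
theorem exists_mem_stdSimplex_forall_sum_rpow_le {X Y : Type*} [Fintype X] [Nonempty X] [Fintype Y]
    {ρ : ℝ} (hρ : 0 < ρ) {V : X → Y → ℝ} (hV : ∀ x y, 0 ≤ V x y) :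
    ∃ P ∈ stdSimplex ℝ X, ∀ x,
      ∑ y, (∑ x', P x' * V x' y) ^ (1 + ρ) ≤ ∑ y, V x y * (∑ x', P x' * V x' y) ^ ρ := by
  classical
  have hρ' : 0 < 1 + ρ := by linarith
  let F : (X → ℝ) → ℝ := fun P => ∑ y, (∑ x', P x' * V x' y) ^ (1 + ρ)
  have hF : Continuous F := by
    refine continuous_finsetSum _ fun y _ => Continuous.rpow_const (by fun_prop)
      fun _ => Or.inr hρ'.le
  have hne : (stdSimplex ℝ X).Nonempty :=
    ⟨_, single_mem_stdSimplex ℝ (Classical.arbitrary X)⟩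
  obtain ⟨P, hP, hmin⟩ := (isCompact_stdSimplex ℝ X).exists_isMinOn hne hF.continuousOn
  refine ⟨P, hP, fun x => ?_⟩
  set g : Y → ℝ := fun y => ∑ x', P x' * V x' y with hg
  have hg0 : ∀ y, 0 ≤ g y := fun y => Finset.sum_nonneg fun i _ => mul_nonneg (hP.1 i) (hV i y)
  -- `G t` is the value of `g` after moving `P` a fraction `t` towards the vertex `x`.
  let G : ℝ → Y → ℝ := fun t y => g y + t * (V x y - g y)
  have hpow : ∀ a : ℝ, 0 ≤ a → a ^ (1 + ρ) = a * a ^ ρ := fun a ha => by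
    rw [Real.rpow_add_of_nonneg ha zero_le_one hρ.le, Real.rpow_one]
  have key : ∀ t ∈ Set.Ioo (0 : ℝ) 1, 0 ≤ ∑ y, (V x y - g y) * G t y ^ ρ := by
    intro t ht
    have hG0 : ∀ y, 0 ≤ G t y := fun y => by
      have : G t y = (1 - t) * g y + t * V x y := by simp only [G]; ring
      rw [this]
      exact add_nonneg (mul_nonneg (by linarith [ht.2]) (hg0 y)) (mul_nonneg ht.1.le (hV x y))
    have hPt : (1 - t) • P + t • Pi.single x 1 ∈ stdSimplex ℝ X :=
      convex_stdSimplex ℝ X hP (single_mem_stdSimplex ℝ x) (by linarith [ht.2]) ht.1.le (by ring)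
    have h1 : ∑ y, g y ^ (1 + ρ) ≤ ∑ y, G t y ^ (1 + ρ) := by
      have h := hmin hPt
      simp only [Set.mem_ofPred_eq, F] at h
      refine h.trans_eq (Finset.sum_congr rfl fun y _ => ?_)
      congr 1
      simp only [Pi.add_apply, Pi.smul_apply, smul_eq_mul, add_mul, Finset.sum_add_distrib,
        mul_assoc, ← Finset.mul_sum, Pi.single_apply, ite_mul, one_mul, zero_mul,
        Finset.sum_ite_eq', Finset.mem_univ, if_true, G, hg]
      ring
    -- Young's inequality, the tangent-line bound for the convex power `1 + ρ` at `G t y`, replaces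
    -- differentiation of `F`.
    have h2 : ∀ y, (1 + ρ) * (g y * G t y ^ ρ) ≤ g y ^ (1 + ρ) + ρ * G t y ^ (1 + ρ) := by
      intro y
      have hpq : (1 + ρ).HolderConjugate ((1 + ρ) / ρ) := by
        rw [Real.holderConjugate_iff]
        exact ⟨by linarith, by field_simp⟩
      have h := Real.young_inequality_of_nonneg (hg0 y) (Real.rpow_nonneg (hG0 y) ρ) hpq
      rw [← Real.rpow_mul (hG0 y), mul_div_cancel₀ _ hρ.ne'] at h
      have := mul_le_mul_of_nonneg_left h hρ'.le
      refine this.trans_eq ?_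
      field_simp
    have h3 : (1 + ρ) * ∑ y, g y * G t y ^ ρ ≤
        ∑ y, g y ^ (1 + ρ) + ρ * ∑ y, G t y ^ (1 + ρ) := by
      rw [Finset.mul_sum, Finset.mul_sum, ← Finset.sum_add_distrib]
      exact Finset.sum_le_sum fun y _ => h2 y
    have h4 : ∑ y, g y * G t y ^ ρ ≤ ∑ y, G t y ^ (1 + ρ) := by
      refine le_of_mul_le_mul_left (h3.trans ?_) hρ'
      linarith
    have h5 : ∑ y, G t y ^ (1 + ρ) - ∑ y, g y * G t y ^ ρ =
        t * ∑ y, (V x y - g y) * G t y ^ ρ := by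
      rw [← Finset.sum_sub_distrib, Finset.mul_sum]
      refine Finset.sum_congr rfl fun y _ => ?_
      rw [hpow _ (hG0 y), ← sub_mul, ← mul_assoc]
      congr 1
      simp only [G]
      ring
    exact nonneg_of_mul_nonneg_right (by rw [← h5]; linarith) ht.1
  have hcont : Continuous fun t : ℝ => ∑ y, (V x y - g y) * G t y ^ ρ := by
    refine continuous_finsetSum _ fun y _ => continuous_const.mul
      (Continuous.rpow_const (by simp only [G]; fun_prop) fun _ => Or.inr hρ.le)
  have hlim : Filter.Tendsto (fun t : ℝ => ∑ y, (V x y - g y) * G t y ^ ρ)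
      (nhdsWithin 0 (Set.Ioi 0)) (nhds (∑ y, (V x y - g y) * g y ^ ρ)) := by
    have := hcont.tendsto 0
    simp only [G, zero_mul, add_zero] at this
    exact this.mono_left nhdsWithin_le_nhds
  have h0 := ge_of_tendsto hlim (Filter.mem_of_superset (Ioo_mem_nhdsGT one_pos) key)
  simp only [sub_mul, Finset.sum_sub_distrib, sub_nonneg] at h0
  refine le_trans (le_of_eq (Finset.sum_congr rfl fun y _ => hpow _ (hg0 y))) h0

namespace DMC

/-- This is where feedback is harmless: for any fixed past, summing over the last output yields at
least `c`, so the last factor can be peeled off. -/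
theorem pow_le_sum_prod_past {Y : Type*} [Fintype Y] {c : ℝ} (hc : 0 ≤ c) {n : ℕ}
    (k : (i : Fin n) → (Fin (i : ℕ) → Y) → Y → ℝ) (hk : ∀ i h y, 0 ≤ k i h y)
    (hsum : ∀ i h, c ≤ ∑ y, k i h y) :
    c ^ n ≤ ∑ y : Fin n → Y, ∏ i, k i (past y i) (y i) := by
  induction n with
  | zero => simp
  | succ n ih =>
    rw [← (Fin.snocEquiv fun _ : Fin (n + 1) => Y).sum_comp, Fintype.sum_prod_type,
      Finset.sum_comm, pow_succ]
    have h := ih (fun i => k i.castSucc) (fun i => hk i.castSucc) (fun i => hsum i.castSucc)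
    refine (mul_le_mul_of_nonneg_right h hc).trans ?_
    rw [Finset.sum_mul]
    refine Finset.sum_le_sum fun y _ => ?_
    have h1 : ∀ b : Y, ∏ i, k i (past (Fin.snoc (α := fun _ => Y) y b) i)
        (Fin.snoc (α := fun _ => Y) y b i) =
        (∏ i : Fin n, k i.castSucc (past y i) (y i)) * k (Fin.last n) y b := by
      intro b
      rw [Fin.prod_univ_castSucc, Fin.snoc_last]
      have h2 : past (Fin.snoc (α := fun _ => Y) y b) (Fin.last n) = y := by
        funext j
        exact Fin.snoc_castSucc (α := fun _ => Y) b y j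
      have h3 : ∀ i : Fin n, past (Fin.snoc (α := fun _ => Y) y b) i.castSucc = past y i := by
        intro i
        funext j
        exact Fin.snoc_castSucc (α := fun _ => Y) b y (Fin.castLE i.isLt.le j)
      rw [h2]
      simp only [h3, Fin.snoc_castSucc]
    simp only [Fin.snocEquiv, Equiv.coe_fn_mk, h1, ← Finset.mul_sum]
    exact mul_le_mul_of_nonneg_left (hsum _ _) (Finset.prod_nonneg fun i _ => hk _ _ _)

end DMC

/-! ### Moments of binomial variables -/

/-- The expectation of `φ` at a binomially distributed number of successes in `M` trials of success
probability `q`. -/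
noncomputable def binomialMean (q : ℝ) : ℕ → (ℕ → ℝ) → ℝ
  | 0, φ => φ 0
  | M + 1, φ => q * binomialMean q M (fun k => φ (k + 1)) + (1 - q) * binomialMean q M φ

namespace binomialMean

variable {q : ℝ}

theorem mono (h0 : 0 ≤ q) (h1 : q ≤ 1) (M : ℕ) {φ ψ : ℕ → ℝ} (h : ∀ k, φ k ≤ ψ k) :
    binomialMean q M φ ≤ binomialMean q M ψ := by
  induction M generalizing φ ψ with
  | zero => exact h 0
  | succ M ih =>
    exact add_le_add (mul_le_mul_of_nonneg_left (ih fun k => h (k + 1)) h0)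
      (mul_le_mul_of_nonneg_left (ih h) (sub_nonneg.2 h1))

theorem add_mul (q : ℝ) (M : ℕ) (φ ψ : ℕ → ℝ) (c : ℝ) :
    binomialMean q M (fun k => φ k + c * ψ k) = binomialMean q M φ + c * binomialMean q M ψ := by
  induction M generalizing φ ψ with
  | zero => rfl
  | succ M ih =>
    simp only [binomialMean, ih]
    ring

theorem affine (q : ℝ) (M : ℕ) (a b : ℝ) :
    binomialMean q M (fun k => a + b * k) = a + b * (M * q) := by
  induction M generalizing a with
  | zero => simp [binomialMean]
  | succ M ih =>
    have : (fun k : ℕ => a + b * ((k + 1 : ℕ) : ℝ)) = fun k : ℕ => (a + b) + b * (k : ℝ) := by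
      funext k; push_cast; ring
    simp only [binomialMean, this, ih]
    push_cast
    ring

/-- By concavity the power lies below its tangent line at the mean `l` (Bernoulli), so only the mean
matters; subadditivity of the power then splits `(1 + l)^ρ`. -/
theorem one_add_rpow_le (h0 : 0 ≤ q) (h1 : q ≤ 1) (M : ℕ) {ρ : ℝ} (hρ0 : 0 ≤ ρ) (hρ1 : ρ ≤ 1) :
    binomialMean q M (fun k => (1 + (k : ℝ)) ^ ρ) ≤ 1 + (M * q) ^ ρ := by
  set l : ℝ := M * q with hl
  have hl0 : 0 ≤ l := by positivity
  have hl1 : 0 < 1 + l := by linarith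
  have hpt : ∀ k : ℕ, (1 + (k : ℝ)) ^ ρ ≤
      ((1 + l) ^ ρ - (1 + l) ^ ρ * ρ / (1 + l) * l) + (1 + l) ^ ρ * ρ / (1 + l) * k := by
    intro k
    have hs : -1 ≤ ((k : ℝ) - l) / (1 + l) := by
      rw [le_div_iff₀ hl1]
      have : (0 : ℝ) ≤ k := k.cast_nonneg
      linarith
    have h := rpow_one_add_le_one_add_mul_self hs hρ0 hρ1
    have h2 : 1 + (k : ℝ) = (1 + l) * (1 + ((k : ℝ) - l) / (1 + l)) := by field_simp; ring
    rw [h2, Real.mul_rpow hl1.le (by linarith)]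
    refine (mul_le_mul_of_nonneg_left h (Real.rpow_nonneg hl1.le _)).trans_eq ?_
    field_simp
    ring
  refine (mono h0 h1 M hpt).trans ?_
  rw [affine, ← hl, sub_add_cancel]
  exact (Real.rpow_add_le_add_rpow zero_le_one hl0 hρ0 hρ1).trans_eq (by rw [Real.one_rpow])

/-- One step of the recursion for moments: from the exponent `ρ - 1` to the exponent `ρ`. -/
theorem one_add_rpow_le_of_sub_one {ρ C : ℝ} (hρ : 1 ≤ ρ) (hC : 0 ≤ C)
    (h : ∀ q : ℝ, 0 ≤ q → q ≤ 1 → ∀ M : ℕ,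
      binomialMean q M (fun k => (1 + (k : ℝ)) ^ (ρ - 1)) ≤ C * (1 + (M * q) ^ (ρ - 1)))
    (h0 : 0 ≤ q) (h1 : q ≤ 1) (M : ℕ) :
    binomialMean q M (fun k => (1 + (k : ℝ)) ^ ρ) ≤
      1 + ρ * 2 ^ (ρ - 1) * C * (M * q + (M * q) ^ ρ) := by
  set c : ℝ := ρ * 2 ^ (ρ - 1) with hc
  have hc0 : 0 ≤ c := by positivity
  have hρ1 : 0 ≤ ρ - 1 := by linarith
  -- A mean value estimate by Bernoulli: the increment is at most `ρ (2 + k)^(ρ - 1)`, and `2 + k ≤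
  -- 2 (1 + k)`.
  have hpt : ∀ k : ℕ, (1 + ((k + 1 : ℕ) : ℝ)) ^ ρ ≤
      (1 + (k : ℝ)) ^ ρ + c * (1 + (k : ℝ)) ^ (ρ - 1) := by
    intro k
    have ht : (0 : ℝ) < 1 + k := by positivity
    have ht2 : (0 : ℝ) < 2 + k := by positivity
    have hs : -1 ≤ -(1 / (2 + (k : ℝ))) := by
      rw [neg_le_neg_iff, div_le_one ht2]
      linarith
    have hb := one_add_mul_self_le_rpow_one_add hs hρ
    have h2 : 1 + (k : ℝ) = (2 + k) * (1 + -(1 / (2 + (k : ℝ)))) := by field_simp; ring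
    have h3 : (2 + (k : ℝ)) ^ ρ = (2 + (k : ℝ)) ^ (ρ - 1) * (2 + k) := by
      rw [← Real.rpow_add_one ht2.ne', sub_add_cancel]
    have h4 : (2 + (k : ℝ)) ^ ρ - ρ * (2 + (k : ℝ)) ^ (ρ - 1) ≤ (1 + (k : ℝ)) ^ ρ := by
      have h5 : (1 + (k : ℝ)) ^ ρ = (2 + (k : ℝ)) ^ ρ * (1 + -(1 / (2 + (k : ℝ)))) ^ ρ := by
        rw [← Real.mul_rpow ht2.le (by linarith), ← h2]
      rw [h5]
      refine le_trans (le_of_eq ?_) (mul_le_mul_of_nonneg_left hb (Real.rpow_nonneg ht2.le _))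
      rw [h3]
      field_simp
      ring
    have h6 : (2 + (k : ℝ)) ^ (ρ - 1) ≤ 2 ^ (ρ - 1) * (1 + (k : ℝ)) ^ (ρ - 1) := by
      rw [← Real.mul_rpow zero_le_two ht.le]
      exact Real.rpow_le_rpow ht2.le (by linarith) hρ1
    have h7 := mul_le_mul_of_nonneg_left h6 (zero_le_one.trans hρ)
    have h8 : (1 + ((k + 1 : ℕ) : ℝ)) = 2 + k := by push_cast; ring
    rw [h8, hc, mul_assoc]
    linarith
  -- One more trial adds the increment only on success, hence the factor `q`.
  have hstep : ∀ N : ℕ, binomialMean q (N + 1) (fun k => (1 + (k : ℝ)) ^ ρ) ≤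
      binomialMean q N (fun k => (1 + (k : ℝ)) ^ ρ) + q * (c * (C * (1 + (N * q) ^ (ρ - 1)))) := by
    intro N
    have ha := mono h0 h1 N hpt
    rw [add_mul q N (fun k => (1 + (k : ℝ)) ^ ρ)] at ha
    have hb := ha.trans (add_le_add_right (mul_le_mul_of_nonneg_left (h q h0 h1 N) hc0) _)
    have := mul_le_mul_of_nonneg_left hb h0
    simp only [binomialMean]
    linarith
  have hmain : ∀ N : ℕ, N ≤ M → binomialMean q N (fun k => (1 + (k : ℝ)) ^ ρ) ≤
      1 + N * (q * (c * (C * (1 + (M * q) ^ (ρ - 1))))) := by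
    intro N
    induction N with
    | zero => intro _; simp [binomialMean]
    | succ N ih =>
      intro hN
      refine (hstep N).trans ?_
      have h9 : (N * q : ℝ) ^ (ρ - 1) ≤ (M * q) ^ (ρ - 1) := by
        refine Real.rpow_le_rpow (by positivity) ?_ hρ1
        exact mul_le_mul_of_nonneg_right (by exact_mod_cast (Nat.le_succ N).trans hN) h0
      have h10 : q * (c * (C * (1 + (N * q) ^ (ρ - 1)))) ≤
          q * (c * (C * (1 + (M * q) ^ (ρ - 1)))) := by gcongr
      have := ih ((Nat.le_succ N).trans hN)
      push_cast
      linarith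
  refine (hmain M le_rfl).trans_eq ?_
  have h11 : (M * q : ℝ) ^ ρ = M * q * (M * q) ^ (ρ - 1) := by
    have hMq : (0 : ℝ) ≤ M * q := by positivity
    have := Real.rpow_add_of_nonneg hMq zero_le_one hρ1
    rwa [add_sub_cancel, Real.rpow_one] at this
  rw [h11]
  ring

/-- Induction on an integer above `ρ`, lowering the exponent by one until it is at most one. -/
theorem exists_one_add_rpow_le {ρ : ℝ} (hρ : 0 ≤ ρ) :
    ∃ C : ℝ, 0 ≤ C ∧ ∀ q : ℝ, 0 ≤ q → q ≤ 1 → ∀ M : ℕ,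
      binomialMean q M (fun k => (1 + (k : ℝ)) ^ ρ) ≤ C * (1 + (M * q) ^ ρ) := by
  obtain ⟨N, hN⟩ := exists_nat_ge ρ
  induction N generalizing ρ with
  | zero =>
    refine ⟨1, zero_le_one, fun q h0 h1 M => ?_⟩
    rw [one_mul]
    exact one_add_rpow_le h0 h1 M hρ (hN.trans (by simp))
  | succ N ih =>
    rcases le_total ρ 1 with h | h
    · exact ⟨1, zero_le_one, fun q h0 h1 M => by
        rw [one_mul]; exact one_add_rpow_le h0 h1 M hρ h⟩
    · push_cast at hN
      obtain ⟨C, hC, hb⟩ := ih (ρ := ρ - 1) (by linarith) (by linarith)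
      refine ⟨1 + 2 * (ρ * 2 ^ (ρ - 1) * C), by positivity, fun q h0 h1 M => ?_⟩
      refine (one_add_rpow_le_of_sub_one h hC hb h0 h1 M).trans ?_
      have hl0 : (0 : ℝ) ≤ M * q := by positivity
      set l : ℝ := M * q
      have hlp : 0 ≤ l ^ ρ := Real.rpow_nonneg hl0 _
      have h2 : l ≤ 1 + l ^ ρ := by
        rcases le_total l 1 with h3 | h3
        · linarith
        · have := Real.rpow_le_rpow_of_exponent_le h3 h
          rw [Real.rpow_one] at this
          linarith
      have hD : 0 ≤ ρ * 2 ^ (ρ - 1) * C := by positivity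
      nlinarith [mul_nonneg hD (sub_nonneg.2 h2)]

/-- The moments of one plus a binomial variable are close to one when its mean is small. -/
theorem exists_one_add_rpow_le_one_add {ρ : ℝ} (hρ : 0 < ρ) :
    ∃ κ C : ℝ, 0 < κ ∧ κ ≤ ρ ∧ 0 ≤ C ∧ ∀ q : ℝ, 0 ≤ q → q ≤ 1 → ∀ M : ℕ,
      binomialMean q M (fun k => (1 + (k : ℝ)) ^ ρ) ≤ 1 + C * ((M * q) ^ κ + (M * q) ^ ρ) := by
  -- `κ` is the smaller of `ρ` and 1.
  rcases le_total ρ 1 with h | h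
  · refine ⟨ρ, 1, hρ, le_rfl, zero_le_one, fun q h0 h1 M => ?_⟩
    refine (one_add_rpow_le h0 h1 M hρ.le h).trans ?_
    have : (0 : ℝ) ≤ (M * q) ^ ρ := by positivity
    linarith
  · obtain ⟨C, hC, hb⟩ := exists_one_add_rpow_le (ρ := ρ - 1) (by linarith)
    refine ⟨1, ρ * 2 ^ (ρ - 1) * C, one_pos, h, by positivity, fun q h0 h1 M => ?_⟩
    rw [Real.rpow_one]
    exact one_add_rpow_le_of_sub_one h hC hb h0 h1 M

end binomialMean

/-- Independent draws from `Q` hit `S` independently, each with probability `∑ a with S a, Q a`;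
conditioning on the first draw reproduces the recursion of `binomialMean`. -/
theorem sum_prod_mul_card_filter_eq_binomialMean {A : Type*} [Fintype A] {Q : A → ℝ}
    (hQ : ∑ a, Q a = 1) (S : A → Prop) [DecidablePred S] (M : ℕ) (φ : ℕ → ℝ) :
    ∑ f : Fin M → A, (∏ m, Q (f m)) * φ ((Finset.univ.filter fun m => S (f m)).card) =
      binomialMean (∑ a with S a, Q a) M φ := by
  induction M generalizing φ with
  | zero => simp [binomialMean]
  | succ M ih =>
    rw [← (Fin.consEquiv fun _ : Fin (M + 1) => A).sum_comp, Fintype.sum_prod_type]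
    have hterm : ∀ a : A, ∑ f : Fin M → A,
        (∏ m, Q ((Fin.consEquiv fun _ : Fin (M + 1) => A) (a, f) m)) *
          φ ((Finset.univ.filter fun m =>
            S ((Fin.consEquiv fun _ : Fin (M + 1) => A) (a, f) m)).card) =
        if S a then Q a * binomialMean (∑ a with S a, Q a) M (fun k => φ (k + 1))
        else Q a * binomialMean (∑ a with S a, Q a) M φ := by
      intro a
      have hcard : ∀ f : Fin M → A, (Finset.univ.filter fun m =>
          S ((Fin.consEquiv fun _ : Fin (M + 1) => A) (a, f) m)).card =
          if S a then (Finset.univ.filter fun m => S (f m)).card + 1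
          else (Finset.univ.filter fun m => S (f m)).card := fun f =>
        Fin.card_filter_univ_succ _
      have hprod : ∀ f : Fin M → A,
          ∏ m, Q ((Fin.consEquiv fun _ : Fin (M + 1) => A) (a, f) m) = Q a * ∏ m, Q (f m) :=
        fun f => Fin.prod_univ_succ _
      simp only [hcard, hprod, mul_assoc, ← Finset.mul_sum]
      split_ifs with h
      · rw [ih (fun k => φ (k + 1))]
      · rw [ih φ]
    simp only [hterm]
    rw [Finset.sum_ite, ← Finset.sum_mul, ← Finset.sum_mul, binomialMean]
    congr 2
    rw [← hQ, ← Finset.sum_filter_add_sum_filter_not Finset.univ S Q]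
    ring

/-! ### Random coding -/

namespace DMC

section RandomCoding

variable {A B : Type*} [Fintype A] [Fintype B]

/-- The mean over a random code of the contribution of one message to the moment of the list. -/
theorem sum_prod_mul_sum_card_rpow_eq {Q : A → ℝ} (hQ : ∑ a, Q a = 1) (p : A → B → ℝ) (ρ : ℝ)
    (M : ℕ) (m : Fin (M + 1)) :
    ∑ f : Fin (M + 1) → A, (∏ i, Q (f i)) *
        ∑ y, p (f m) y * ((Finset.univ.filter fun i => p (f m) y ≤ p (f i) y).card : ℝ) ^ ρ =
      ∑ a, ∑ y, Q a * p a y *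
        binomialMean (∑ a' with p a y ≤ p a' y, Q a') M (fun k => (1 + (k : ℝ)) ^ ρ) := by
  rw [← (Fin.insertNthEquiv (fun _ : Fin (M + 1) => A) m).sum_comp, Fintype.sum_prod_type]
  refine Finset.sum_congr rfl fun a _ => ?_
  have hm : ∀ f : Fin M → A, Fin.insertNthEquiv (fun _ : Fin (M + 1) => A) m (a, f) m = a :=
    fun f => Fin.insertNth_apply_same (α := fun _ : Fin (M + 1) => A) m a f
  have hi : ∀ (f : Fin M → A) i,
      Fin.insertNthEquiv (fun _ : Fin (M + 1) => A) m (a, f) (m.succAbove i) = f i :=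
    fun f i => Fin.insertNth_apply_succAbove (α := fun _ : Fin (M + 1) => A) m a f i
  have hprod : ∀ f : Fin M → A,
      ∏ i, Q (Fin.insertNthEquiv (fun _ : Fin (M + 1) => A) m (a, f) i) = Q a * ∏ i, Q (f i) := by
    intro f
    rw [Fin.prod_univ_succAbove _ m, hm]
    simp only [hi]
  -- The summand 1 is the message `m` itself, always on its own list.
  have hcard : ∀ (f : Fin M → A) (y : B), ((Finset.univ.filter fun i =>
      p (Fin.insertNthEquiv (fun _ : Fin (M + 1) => A) m (a, f) m) y ≤
        p (Fin.insertNthEquiv (fun _ : Fin (M + 1) => A) m (a, f) i) y).card : ℝ) =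
      1 + ((Finset.univ.filter fun i => p a y ≤ p (f i) y).card : ℝ) := by
    intro f y
    rw [Finset.card_filter, Finset.card_filter, Fin.sum_univ_succAbove _ m]
    simp only [hm, hi, le_refl, if_true]
    push_cast
    rfl
  simp only [hcard]
  simp only [hprod, hm, Finset.mul_sum]
  rw [Finset.sum_comm]
  refine Finset.sum_congr rfl fun y _ => ?_
  rw [← sum_prod_mul_card_filter_eq_binomialMean hQ (fun a' => p a y ≤ p a' y) M
    (fun k => (1 + (k : ℝ)) ^ ρ), Finset.mul_sum]
  refine Finset.sum_congr rfl fun f _ => ?_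
  ring

/-- Gallager's bound for the moments of the mean number of wrong messages in the list. -/
theorem sum_mul_rpow_le {Q : A → ℝ} (hQ : ∀ a, 0 ≤ Q a) {p : A → B → ℝ} (hp : ∀ a y, 0 ≤ p a y)
    {ρ : ℝ} (hρ : 0 < ρ) {t : ℝ} (ht : 0 ≤ t) :
    ∑ a, ∑ y, Q a * p a y * (t * ∑ a' with p a y ≤ p a' y, Q a') ^ ρ ≤
      t ^ ρ * ∑ y, (∑ a, Q a * p a y ^ (1 / (1 + ρ))) ^ (1 + ρ) := by
  have hρ' : 0 < 1 + ρ := by linarith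
  set u : B → ℝ := fun y => ∑ a, Q a * p a y ^ (1 / (1 + ρ)) with hu
  have hu0 : ∀ y, 0 ≤ u y := fun y => Finset.sum_nonneg fun a _ =>
    mul_nonneg (hQ a) (Real.rpow_nonneg (hp a y) _)
  have hterm : ∀ a y, Q a * p a y * (t * ∑ a' with p a y ≤ p a' y, Q a') ^ ρ ≤
      t ^ ρ * (Q a * p a y ^ (1 / (1 + ρ)) * u y ^ ρ) := by
    intro a y
    set q : ℝ := ∑ a' with p a y ≤ p a' y, Q a' with hq
    have hq0 : 0 ≤ q := Finset.sum_nonneg fun a _ => hQ a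
    have hpa := Real.rpow_nonneg (hp a y) (1 / (1 + ρ))
    -- Gallager's bound of an indicator by a likelihood ratio to the power `1/(1+ρ)`, multiplied out
    -- so that `p a y = 0` is harmless.
    have h1 : p a y ^ (1 / (1 + ρ)) * q ≤ u y := by
      rw [hq, Finset.mul_sum]
      refine (Finset.sum_le_sum fun a' ha' => ?_).trans
        (Finset.sum_le_sum_of_subset_of_nonneg (Finset.filter_subset _ _) fun a' _ _ =>
          mul_nonneg (hQ a') (Real.rpow_nonneg (hp a' y) _))
      rw [mul_comm]
      exact mul_le_mul_of_nonneg_left (Real.rpow_le_rpow (hp a y) (Finset.mem_filter.1 ha').2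
        (by positivity)) (hQ a')
    have h2 : p a y * q ^ ρ = p a y ^ (1 / (1 + ρ)) * (p a y ^ (1 / (1 + ρ)) * q) ^ ρ := by
      rw [Real.mul_rpow hpa hq0, ← Real.rpow_mul (hp a y), ← mul_assoc,
        ← Real.rpow_add_of_nonneg (hp a y) (by positivity) (by positivity)]
      have : 1 / (1 + ρ) + 1 / (1 + ρ) * ρ = 1 := by field_simp
      rw [this, Real.rpow_one]
    have h3 : p a y * q ^ ρ ≤ p a y ^ (1 / (1 + ρ)) * u y ^ ρ := by
      rw [h2]
      exact mul_le_mul_of_nonneg_left (Real.rpow_le_rpow (mul_nonneg hpa hq0) h1 hρ.le) hpa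
    rw [Real.mul_rpow ht hq0]
    have h4 := mul_le_mul_of_nonneg_left h3 (mul_nonneg (Real.rpow_nonneg ht ρ) (hQ a))
    linarith
  refine (Finset.sum_le_sum fun a _ => Finset.sum_le_sum fun y _ => hterm a y).trans_eq ?_
  rw [Finset.sum_comm]
  simp only [← Finset.mul_sum, ← Finset.sum_mul]
  congr 1
  refine Finset.sum_congr rfl fun y _ => ?_
  rw [Real.rpow_add_of_nonneg (hu0 y) zero_le_one hρ.le, Real.rpow_one]

/-- Some code is no worse than the average over random codes. -/
theorem exists_listMoment_le {Y : Type*} [Fintype Y] {n : ℕ} {Q : A → ℝ} (hQ : ∀ a, 0 ≤ Q a)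
    (hQ1 : ∑ a, Q a = 1) {p : A → (Fin n → Y) → ℝ} (hp : ∀ a y, 0 ≤ p a y)
    (hp1 : ∀ a, ∑ y, p a y = 1) {ρ κ C : ℝ} (hκ : 0 < κ) (hκρ : κ ≤ ρ) (hC : 0 ≤ C)
    (hmean : ∀ q : ℝ, 0 ≤ q → q ≤ 1 → ∀ M : ℕ,
      binomialMean q M (fun k => (1 + (k : ℝ)) ^ ρ) ≤ 1 + C * ((M * q) ^ κ + (M * q) ^ ρ))
    {M : ℕ} (hM : 0 < M) {T : ℝ}
    (hT : (M : ℝ) ^ ρ * ∑ y, (∑ a, Q a * p a y ^ (1 / (1 + ρ))) ^ (1 + ρ) ≤ T) :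
    ∃ f : Fin M → A, listMoment ρ (fun m => p (f m)) ≤ 1 + C * (T ^ (κ / ρ) + T) := by
  classical
  have hρ : 0 < ρ := hκ.trans_le hκρ
  obtain ⟨M, rfl⟩ : ∃ N, M = N + 1 := ⟨M - 1, by omega⟩
  set D : ℝ := 1 + C * (T ^ (κ / ρ) + T) with hD
  let q : A → (Fin n → Y) → ℝ := fun a y => ∑ a' with p a y ≤ p a' y, Q a'
  have hq0 : ∀ a y, 0 ≤ q a y := fun a y => Finset.sum_nonneg fun a _ => hQ a
  have hq1 : ∀ a y, q a y ≤ 1 := fun a y => by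
    rw [← hQ1]
    exact Finset.sum_le_sum_of_subset_of_nonneg (Finset.filter_subset _ _) fun a _ _ => hQ a
  let l : A → (Fin n → Y) → ℝ := fun a y => ((M + 1 : ℕ) : ℝ) * q a y
  have hl0 : ∀ a y, 0 ≤ l a y := fun a y => mul_nonneg (Nat.cast_nonneg _) (hq0 a y)
  have hw0 : ∀ a y, 0 ≤ Q a * p a y := fun a y => mul_nonneg (hQ a) (hp a y)
  have hw1 : ∑ a, ∑ y, Q a * p a y = 1 := by
    simp only [← Finset.mul_sum, hp1, mul_one, hQ1]
  have hlρ : ∑ a, ∑ y, Q a * p a y * l a y ^ ρ ≤ T :=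
    (sum_mul_rpow_le hQ hp hρ (Nat.cast_nonneg _)).trans hT
  -- The power mean inequality with exponent `ρ / κ ≥ 1` reduces the `κ`-th moment to the `ρ`-th.
  have hlκ : ∑ a, ∑ y, Q a * p a y * l a y ^ κ ≤ T ^ (κ / ρ) := by
    have h := Real.arith_mean_le_rpow_mean (Finset.univ : Finset (A × (Fin n → Y)))
      (fun z => Q z.1 * p z.1 z.2) (fun z => l z.1 z.2 ^ κ) (fun z _ => hw0 _ _)
      (by rw [Fintype.sum_prod_type]; exact hw1) (fun z _ => Real.rpow_nonneg (hl0 _ _) _)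
      (p := ρ / κ) ((one_le_div hκ).2 hκρ)
    have he : ∀ a y, (l a y ^ κ) ^ (ρ / κ) = l a y ^ ρ := fun a y => by
      rw [← Real.rpow_mul (hl0 a y), mul_div_cancel₀ _ hκ.ne']
    simp only [Fintype.sum_prod_type, he, one_div_div] at h
    refine h.trans (Real.rpow_le_rpow ?_ hlρ (by positivity))
    exact Finset.sum_nonneg fun a _ => Finset.sum_nonneg fun y _ =>
      mul_nonneg (hw0 a y) (Real.rpow_nonneg (hl0 a y) _)
  have hb : ∑ a, ∑ y, Q a * p a y * binomialMean (q a y) M (fun k => (1 + (k : ℝ)) ^ ρ) ≤ D := by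
    have hpt : ∀ a y, Q a * p a y * binomialMean (q a y) M (fun k => (1 + (k : ℝ)) ^ ρ) ≤
        Q a * p a y + C * (Q a * p a y * l a y ^ κ + Q a * p a y * l a y ^ ρ) := by
      intro a y
      have hle : (M : ℝ) * q a y ≤ l a y :=
        mul_le_mul_of_nonneg_right (by exact_mod_cast Nat.le_succ M) (hq0 a y)
      have hle0 : 0 ≤ (M : ℝ) * q a y := mul_nonneg (Nat.cast_nonneg _) (hq0 a y)
      have h1 := hmean (q a y) (hq0 a y) (hq1 a y) M
      have h2 : 1 + C * (((M : ℝ) * q a y) ^ κ + ((M : ℝ) * q a y) ^ ρ) ≤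
          1 + C * (l a y ^ κ + l a y ^ ρ) := by
        gcongr
      refine (mul_le_mul_of_nonneg_left (h1.trans h2) (hw0 a y)).trans_eq ?_
      ring
    refine (Finset.sum_le_sum fun a _ => Finset.sum_le_sum fun y _ => hpt a y).trans ?_
    have hsplit : ∑ a, ∑ y, (Q a * p a y +
        C * (Q a * p a y * l a y ^ κ + Q a * p a y * l a y ^ ρ)) =
        ∑ a, ∑ y, Q a * p a y + C * (∑ a, ∑ y, Q a * p a y * l a y ^ κ +
          ∑ a, ∑ y, Q a * p a y * l a y ^ ρ) := by
      simp only [Finset.sum_add_distrib, mul_add, Finset.mul_sum]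
    rw [hsplit, hw1, hD]
    gcongr
  have hw : ∑ f : Fin (M + 1) → A, ∏ i, Q (f i) = 1 := by
    rw [← Fintype.sum_pow, hQ1, one_pow]
  have havg : ∑ f : Fin (M + 1) → A, (∏ i, Q (f i)) * listMoment ρ (fun m => p (f m)) ≤ D := by
    have h1 : ∑ f : Fin (M + 1) → A, (∏ i, Q (f i)) * listMoment ρ (fun m => p (f m)) =
        ((M + 1 : ℕ) : ℝ)⁻¹ * ∑ m : Fin (M + 1), ∑ f : Fin (M + 1) → A, (∏ i, Q (f i)) *
          ∑ y, p (f m) y *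
            ((Finset.univ.filter fun i => p (f m) y ≤ p (f i) y).card : ℝ) ^ ρ := by
      rw [Finset.sum_comm, Finset.mul_sum]
      refine Finset.sum_congr rfl fun f _ => ?_
      simp only [listMoment, likelyList, ← Finset.mul_sum]
      ring
    rw [h1]
    simp only [sum_prod_mul_sum_card_rpow_eq hQ1, Finset.sum_const, Finset.card_univ,
      Fintype.card_fin, nsmul_eq_mul]
    rw [inv_mul_cancel_left₀ (by positivity)]
    exact hb
  -- If every code exceeded `D`, the nonnegative weighted excesses would sum to at most zero, so all
  -- weights would vanish, although they sum to one.
  by_contra! hcon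
  have h0 : ∑ f : Fin (M + 1) → A, (∏ i, Q (f i)) * (listMoment ρ (fun m => p (f m)) - D) ≤ 0 := by
    simp only [mul_sub, Finset.sum_sub_distrib, ← Finset.sum_mul, hw]
    linarith
  have hnn : ∀ f ∈ (Finset.univ : Finset (Fin (M + 1) → A)),
      0 ≤ (∏ i, Q (f i)) * (listMoment ρ (fun m => p (f m)) - D) := fun f _ =>
    mul_nonneg (Finset.prod_nonneg fun i _ => hQ _) (sub_nonneg.2 (hcon f).le)
  have hz := (Finset.sum_eq_zero_iff_of_nonneg hnn).1 (le_antisymm h0 (Finset.sum_nonneg hnn))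
  have : ∑ f : Fin (M + 1) → A, ∏ i, Q (f i) = 0 := Finset.sum_eq_zero fun f hf =>
    (mul_eq_zero.1 (hz f hf)).resolve_right (sub_pos.2 (hcon f)).ne'
  linarith

end RandomCoding

/-! ### Converse with feedback -/

variable {X Y : Type*} [Fintype Y]

theorem one_le_listMoment {ρ : ℝ} (hρ : 0 ≤ ρ) {n M : ℕ} (hM : 0 < M)
    {p : Fin M → (Fin n → Y) → ℝ} (hp : ∀ m y, 0 ≤ p m y) (hp1 : ∀ m, ∑ y, p m y = 1) :
    1 ≤ listMoment ρ p := by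
  have h : ∀ m, 1 ≤ ∑ y, p m y * ((likelyList p m y).card : ℝ) ^ ρ := fun m => by
    rw [← hp1 m]
    refine Finset.sum_le_sum fun y _ => le_mul_of_one_le_right (hp m y) ?_
    refine Real.one_le_rpow ?_ hρ
    exact_mod_cast Finset.card_pos.2 ⟨m, by simp [likelyList]⟩
  have hM' : (0 : ℝ) < M := by exact_mod_cast hM
  rw [listMoment, inv_mul_eq_div, le_div_iff₀ hM', one_mul]
  calc (M : ℝ) = ∑ _m : Fin M, (1 : ℝ) := by simp
    _ ≤ _ := Finset.sum_le_sum fun m _ => h m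

theorem sum_likelihood (W : DMC X Y) {n M : ℕ} (f : Encoder X n M) (m : Fin M) :
    ∑ y, W.likelihood f m y = 1 := by
  classical
  simp only [likelihood]
  rw [← Fintype.piFinset_univ, ← Finset.prod_univ_sum (fun _ => Finset.univ)
    (fun i y => W.law (f m i) y)]
  simp [W.law_sum]

theorem likelihood_nonneg (W : DMC X Y) {n M : ℕ} (f : Encoder X n M) (m : Fin M)
    (y : Fin n → Y) : 0 ≤ W.likelihood f m y :=
  Finset.prod_nonneg fun _ _ => W.law_nonneg _ _

/-- The converse for feedback encoders, from an auxiliary function `g` on the output alphabet. -/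
theorem rpow_mul_pow_le_listMoment_feedback (W : DMC X Y) {ρ : ℝ} (hρ : 0 < ρ) {g : Y → ℝ}
    (hg : ∀ y, 0 ≤ g y) {γ : ℝ} (hγ : 0 < γ) (hγg : ∑ y, g y ^ (1 + ρ) = γ)
    (hopt : ∀ x, γ ≤ ∑ y, W.law x y ^ (1 / (1 + ρ)) * g y ^ ρ) {n M : ℕ} (hM : 0 < M)
    (f : FeedbackEncoder X Y n M) :
    (M : ℝ) ^ ρ * γ ^ n ≤ (1 + Real.log M) ^ ρ * listMoment ρ (W.feedbackLikelihood f) := by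
  have hρ' : 0 < 1 + ρ := by linarith
  have hM' : (0 : ℝ) < M := by exact_mod_cast hM
  have hγn : 0 < γ ^ n := pow_pos hγ n
  set p := W.feedbackLikelihood f with hp
  have hp0 : ∀ m y, 0 ≤ p m y := fun m y => Finset.prod_nonneg fun _ _ => W.law_nonneg _ _
  let a : (Fin n → Y) → ℝ := fun y => ∑ m, p m y ^ (1 / (1 + ρ))
  have ha : ∀ y, 0 ≤ a y := fun y => Finset.sum_nonneg fun m _ => Real.rpow_nonneg (hp0 m y) _
  let h : (Fin n → Y) → ℝ := fun y => ∏ i, g (y i)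
  have hh : ∀ y, 0 ≤ h y := fun y => Finset.prod_nonneg fun i _ => hg _
  have h1 : (M : ℝ) * γ ^ n ≤ ∑ y, a y * h y ^ ρ := by
    have hm : ∀ m, γ ^ n ≤ ∑ y, p m y ^ (1 / (1 + ρ)) * h y ^ ρ := by
      intro m
      refine (pow_le_sum_prod_past hγ.le
        (fun i hist y => W.law (f i m hist) y ^ (1 / (1 + ρ)) * g y ^ ρ)
        (fun i hist y => mul_nonneg (Real.rpow_nonneg (W.law_nonneg _ _) _)
          (Real.rpow_nonneg (hg y) _)) fun i hist => hopt _).trans_eq ?_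
      refine Finset.sum_congr rfl fun y _ => ?_
      rw [Finset.prod_mul_distrib, Real.finsetProd_rpow _ _ fun i _ => W.law_nonneg _ _,
        Real.finsetProd_rpow _ _ fun i _ => hg _]
      rfl
    calc (M : ℝ) * γ ^ n = ∑ _m : Fin M, γ ^ n := by simp
      _ ≤ ∑ m, ∑ y, p m y ^ (1 / (1 + ρ)) * h y ^ ρ := Finset.sum_le_sum fun m _ => hm m
      _ = _ := by rw [Finset.sum_comm]; simp only [a, Finset.sum_mul]
  have h2 : ∑ y, h y ^ (1 + ρ) = γ ^ n := by
    rw [← hγg, Fintype.sum_pow]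
    exact Finset.sum_congr rfl fun y _ => (Real.finsetProd_rpow _ _ (fun i _ => hg _) _).symm
  have h3 := Real.rpow_one_add_sum_mul_rpow_le Finset.univ hρ ha hh
  rw [h2] at h3
  have h4 : ∑ y, a y ^ (1 + ρ) ≤ (1 + Real.log M) ^ ρ * (M * listMoment ρ p) := by
    have : (M : ℝ) * listMoment ρ p =
        ∑ y, ∑ m, p m y * ((likelyList p m y).card : ℝ) ^ ρ := by
      rw [listMoment, mul_inv_cancel_left₀ hM'.ne', Finset.sum_comm]
    rw [this, Finset.mul_sum]
    refine Finset.sum_le_sum fun y _ => ?_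
    have := Real.rpow_one_add_sum_rpow_le hρ (p := fun m => p m y) fun m => hp0 m y
    rwa [Fintype.card_fin] at this
  have h5 : ((M : ℝ) * γ ^ n) ^ (1 + ρ) ≤
      (1 + Real.log M) ^ ρ * (M * listMoment ρ p) * (γ ^ n) ^ ρ :=
    (Real.rpow_le_rpow (by positivity) h1 hρ'.le).trans
      (h3.trans (mul_le_mul_of_nonneg_right h4 (Real.rpow_nonneg hγn.le _)))
  -- This exposes the common factor `M * (γ ^ n) ^ ρ`, which is then cancelled.
  have h6 : ((M : ℝ) * γ ^ n) ^ (1 + ρ) =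
      ((M : ℝ) ^ ρ * γ ^ n) * (M * (γ ^ n) ^ ρ) := by
    rw [Real.rpow_add (by positivity), Real.rpow_one, Real.mul_rpow hM'.le hγn.le]
    ring
  rw [h6] at h5
  refine le_of_mul_le_mul_right (h5.trans_eq ?_)
    (mul_pos hM' (Real.rpow_pos_of_pos hγn ρ))
  ring

end DMC

/-! ### From code bounds to rates -/

namespace DMC

variable {X Y : Type*} [Fintype Y]

theorem numMessages_le {R : ℝ} (n : ℕ) : (numMessages n R : ℝ) ≤ Real.exp (n * R) :=
  Nat.floor_le (Real.exp_pos _).le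

theorem numMessages_pos {R : ℝ} (hR : 0 ≤ R) (n : ℕ) : 0 < numMessages n R :=
  Nat.floor_pos.2 (Real.one_le_exp (by positivity))

theorem exp_div_two_le_numMessages {R : ℝ} (hR : 0 ≤ R) (n : ℕ) :
    Real.exp (n * R) / 2 ≤ numMessages n R := by
  have h1 := Nat.lt_floor_add_one (Real.exp (n * R))
  have h2 : (1 : ℝ) ≤ numMessages n R := by exact_mod_cast numMessages_pos hR n
  rw [numMessages] at h2 ⊢
  linarith

theorem cutoffAchievable_subset_feedback (W : DMC X Y) (ρ : ℝ) :
    W.cutoffAchievable ρ ⊆ W.cutoffAchievableFeedback ρ := by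
  rintro R ⟨f, hf⟩
  exact ⟨fun n i m _ => f n m i, hf⟩

theorem zero_mem_cutoffAchievable [Nonempty X] (W : DMC X Y) (ρ : ℝ) :
    0 ∈ W.cutoffAchievable ρ := by
  refine ⟨fun n _ _ => Classical.arbitrary X, ?_⟩
  have h1 : ∀ n, numMessages n 0 = 1 := fun n => by simp [numMessages]
  refine tendsto_const_nhds.congr fun n => ?_
  have hsub : Subsingleton (Fin (numMessages n 0)) := by rw [h1]; infer_instance
  have hcard : ∀ (m : Fin (numMessages n 0)) (y : Fin n → Y),
      (likelyList (W.likelihood fun (_ : Fin (numMessages n 0)) (_ : Fin n) =>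
        Classical.arbitrary X) m y).card = 1 := by
    intro m y
    refine Finset.card_eq_one.2 ⟨m, ?_⟩
    ext m'
    simp [likelyList, Subsingleton.elim m' m]
  simp only [listMoment, hcard, Nat.cast_one, Real.one_rpow, mul_one, sum_likelihood]
  simp [h1]

theorem tendsto_exp_mul_div_atTop {δ R : ℝ} (hδ : 0 < δ) (hR : 0 ≤ R) :
    Filter.Tendsto (fun n : ℕ => Real.exp (n * δ) / (2 * (1 + n * R))) Filter.atTop
      Filter.atTop := by
  -- The slope comes from `exp z ≥ z² / 2` at `z = nδ` and `1 + nR ≤ n (1 + R)`.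
  have hlin : Filter.Tendsto (fun n : ℕ => (n : ℝ) * (δ ^ 2 / (4 * (1 + R)))) Filter.atTop
      Filter.atTop := tendsto_natCast_atTop_atTop.atTop_mul_const (by positivity)
  refine Filter.tendsto_atTop_mono' _ ?_ hlin
  filter_upwards [Filter.eventually_ge_atTop 1] with n hn
  have hn' : (1 : ℝ) ≤ n := by exact_mod_cast hn
  have h1 := Real.quadratic_le_exp_of_nonneg (x := n * δ) (by positivity)
  have h2 : 0 ≤ (n : ℝ) * δ := by positivity
  rw [le_div_iff₀ (by positivity)]
  calc (n : ℝ) * (δ ^ 2 / (4 * (1 + R))) * (2 * (1 + n * R))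
      ≤ (n : ℝ) * (δ ^ 2 / (4 * (1 + R))) * (2 * (n + n * R)) := by gcongr
    _ = (n * δ) ^ 2 / 2 := by field_simp; ring
    _ ≤ Real.exp (n * δ) := by linarith

theorem le_of_mem_cutoffAchievableFeedback (W : DMC X Y) {ρ : ℝ} (hρ : 0 < ρ) {g : Y → ℝ}
    (hg : ∀ y, 0 ≤ g y) {C : ℝ} (hγg : ∑ y, g y ^ (1 + ρ) = Real.exp (-(ρ * C)))
    (hopt : ∀ x, Real.exp (-(ρ * C)) ≤ ∑ y, W.law x y ^ (1 / (1 + ρ)) * g y ^ ρ)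
    {R : ℝ} (hRmem : R ∈ W.cutoffAchievableFeedback ρ) : R ≤ C := by
  obtain ⟨f, hf⟩ := hRmem
  by_contra! hCR
  rcases lt_or_ge R 0 with hR | hR
  -- At a negative rate there are no messages once `n ≥ 1`, so the moment is 0 by convention and
  -- cannot tend to 1.
  · have h0 : ∀ᶠ n : ℕ in Filter.atTop, (0 : ℝ) = listMoment ρ (W.feedbackLikelihood (f n)) := by
      filter_upwards [Filter.eventually_ge_atTop 1] with n hn
      have hn' : (0 : ℝ) < n := by exact_mod_cast hn
      have : numMessages n R = 0 :=
        Nat.floor_eq_zero.2 (Real.exp_lt_one_iff.2 (mul_neg_of_pos_of_neg hn' hR))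
      simp [listMoment, this]
    exact zero_ne_one (tendsto_nhds_unique (tendsto_const_nhds.congr' h0) hf)
  · have hδ : 0 < R - C := sub_pos.2 hCR
    have hlow : ∀ n : ℕ, (Real.exp (n * (R - C)) / (2 * (1 + n * R))) ^ ρ ≤
        listMoment ρ (W.feedbackLikelihood (f n)) := by
      intro n
      have hM := numMessages_pos hR n
      have hM1 : (1 : ℝ) ≤ numMessages n R := by exact_mod_cast hM
      have h := W.rpow_mul_pow_le_listMoment_feedback hρ hg (Real.exp_pos _) hγg hopt hM (f n)
      have hlog0 : 0 ≤ Real.log (numMessages n R) := Real.log_nonneg hM1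
      have hlog : Real.log (numMessages n R) ≤ n * R := by
        rw [← Real.log_exp (n * R)]
        exact Real.log_le_log (by linarith) (numMessages_le n)
      have hpow : Real.exp (-(ρ * C)) ^ n = Real.exp (-(n * C)) ^ ρ := by
        rw [← Real.exp_nat_mul, ← Real.exp_mul]
        congr 1
        ring
      rw [hpow, ← Real.mul_rpow (by positivity) (Real.exp_pos _).le] at h
      have h2 : (numMessages n R * Real.exp (-(n * C)) / (1 + Real.log (numMessages n R))) ^ ρ ≤
          listMoment ρ (W.feedbackLikelihood (f n)) := by
        rw [Real.div_rpow (by positivity) (by positivity), div_le_iff₀' (by positivity)]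
        exact h
      refine (Real.rpow_le_rpow (by positivity) ?_ hρ.le).trans h2
      have h3 : Real.exp (n * (R - C)) / (2 * (1 + n * R)) =
          Real.exp (n * R) / 2 * Real.exp (-(n * C)) / (1 + n * R) := by
        rw [show (n : ℝ) * (R - C) = n * R + -(n * C) by ring, Real.exp_add]
        field_simp
      rw [h3]
      have := exp_div_two_le_numMessages hR n
      gcongr
    exact not_tendsto_nhds_of_tendsto_atTop (Filter.tendsto_atTop_mono hlow
      ((tendsto_rpow_atTop hρ).comp (tendsto_exp_mul_div_atTop hδ hR))) 1 hf

/-- Gallager's sum factorizes over the letters for a product input law on a memoryless channel. -/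
theorem sum_prod_mul_likelihood_rpow [Fintype X] (W : DMC X Y) {P : X → ℝ} (hP : ∀ x, 0 ≤ P x)
    (α : ℝ) (r : ℝ) (n : ℕ) :
    ∑ y : Fin n → Y, (∑ a : Fin n → X, (∏ i, P (a i)) * (∏ i, W.law (a i) (y i)) ^ α) ^ r =
      (∑ y, (∑ x, P x * W.law x y ^ α) ^ r) ^ n := by
  classical
  rw [Fintype.sum_pow]
  refine Finset.sum_congr rfl fun y _ => ?_
  rw [Real.finsetProd_rpow _ _ fun i _ => Finset.sum_nonneg fun x _ =>
    mul_nonneg (hP x) (Real.rpow_nonneg (W.law_nonneg _ _) _)]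
  congr 1
  rw [Finset.prod_univ_sum (fun _ => Finset.univ) (fun i x => P x * W.law x (y i) ^ α),
    Fintype.piFinset_univ]
  refine Finset.sum_congr rfl fun a _ => ?_
  rw [Finset.prod_mul_distrib, Real.finsetProd_rpow _ _ fun i _ => W.law_nonneg _ _]

theorem mem_cutoffAchievable_of_lt [Fintype X] (W : DMC X Y) {ρ : ℝ} (hρ : 0 < ρ) {P : X → ℝ}
    (hP : P ∈ stdSimplex ℝ X) {C : ℝ}
    (hγ : ∑ y, (∑ x, P x * W.law x y ^ (1 / (1 + ρ))) ^ (1 + ρ) = Real.exp (-(ρ * C)))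
    {R : ℝ} (hR : 0 ≤ R) (hRC : R < C) : R ∈ W.cutoffAchievable ρ := by
  obtain ⟨κ, D, hκ, hκρ, hD, hmean⟩ := binomialMean.exists_one_add_rpow_le_one_add hρ
  -- A geometric sequence, of ratio below one exactly because `R < C`.
  let T : ℕ → ℝ := fun n => Real.exp (-(ρ * (C - R))) ^ n
  have hT : ∀ n, (numMessages n R : ℝ) ^ ρ * Real.exp (-(ρ * C)) ^ n ≤ T n := by
    intro n
    refine (mul_le_mul_of_nonneg_right (Real.rpow_le_rpow (Nat.cast_nonneg _)
      (numMessages_le n) hρ.le) (by positivity)).trans_eq ?_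
    simp only [T]
    rw [← Real.exp_mul, ← Real.exp_nat_mul, ← Real.exp_nat_mul, ← Real.exp_add]
    congr 1
    ring
  have hex : ∀ n, ∃ f : Encoder X n (numMessages n R),
      listMoment ρ (W.likelihood f) ≤ 1 + D * (T n ^ (κ / ρ) + T n) := by
    intro n
    refine exists_listMoment_le (Q := fun a : Fin n → X => ∏ i, P (a i))
      (p := fun a y => ∏ i, W.law (a i) (y i))
      (fun a => Finset.prod_nonneg fun i _ => hP.1 _) ?_
      (fun a y => Finset.prod_nonneg fun i _ => W.law_nonneg _ _)
      -- A single codeword is treated as a code with one message.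
      (fun a => W.sum_likelihood (fun _ : Fin 1 => a) 0) hκ hκρ hD hmean
      (numMessages_pos hR n) ?_
    · rw [← Fintype.sum_pow, hP.2, one_pow]
    · rw [W.sum_prod_mul_likelihood_rpow hP.1, hγ]
      exact hT n
  choose f hf using hex
  have hT0 : Filter.Tendsto T Filter.atTop (nhds 0) := by
    refine tendsto_pow_atTop_nhds_zero_of_lt_one (Real.exp_pos _).le (Real.exp_lt_one_iff.2 ?_)
    have := mul_pos hρ (sub_pos.2 hRC)
    linarith
  have hTκ : Filter.Tendsto (fun n => T n ^ (κ / ρ)) Filter.atTop (nhds 0) := by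
    have hpos : 0 < κ / ρ := div_pos hκ hρ
    have := hT0.rpow_const (p := κ / ρ) (Or.inr hpos.le)
    rwa [Real.zero_rpow hpos.ne'] at this
  have hlim : Filter.Tendsto (fun n => 1 + D * (T n ^ (κ / ρ) + T n)) Filter.atTop (nhds 1) := by
    simpa using ((hTκ.add hT0).const_mul D).const_add 1
  exact ⟨f, tendsto_of_tendsto_of_tendsto_of_le_of_le tendsto_const_nhds hlim
    (fun n => one_le_listMoment hρ.le (numMessages_pos hR n) (W.likelihood_nonneg (f n))
      (W.sum_likelihood (f n))) hf⟩

/-- The same minimizer `P` serves as random coding law and, through `g`, in the converse. -/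
theorem exists_isLUB_cutoffAchievable [Fintype X] [Nonempty X] (W : DMC X Y) {ρ : ℝ}
    (hρ : 0 < ρ) :
    ∃ C, IsLUB (W.cutoffAchievable ρ) C ∧ IsLUB (W.cutoffAchievableFeedback ρ) C := by
  obtain ⟨P, hP, hopt⟩ := exists_mem_stdSimplex_forall_sum_rpow_le hρ
    (V := fun x y => W.law x y ^ (1 / (1 + ρ))) fun x y => Real.rpow_nonneg (W.law_nonneg x y) _
  set g : Y → ℝ := fun y => ∑ x, P x * W.law x y ^ (1 / (1 + ρ)) with hgdef
  have hg : ∀ y, 0 ≤ g y := fun y => Finset.sum_nonneg fun x _ =>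
    mul_nonneg (hP.1 x) (Real.rpow_nonneg (W.law_nonneg x y) _)
  have hγ : 0 < ∑ y, g y ^ (1 + ρ) := by
    obtain ⟨x, -, hx⟩ : ∃ x ∈ Finset.univ, 0 < P x :=
      Finset.exists_lt_of_sum_lt (by simp [hP.2])
    obtain ⟨y, -, hy⟩ : ∃ y ∈ Finset.univ, 0 < W.law x y :=
      Finset.exists_lt_of_sum_lt (by simp [W.law_sum])
    refine Finset.sum_pos' (fun y _ => Real.rpow_nonneg (hg y) _) ⟨y, Finset.mem_univ y, ?_⟩
    refine Real.rpow_pos_of_pos (Finset.sum_pos' (fun x _ =>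
      mul_nonneg (hP.1 x) (Real.rpow_nonneg (W.law_nonneg x y) _)) ⟨x, Finset.mem_univ x, ?_⟩) _
    exact mul_pos hx (Real.rpow_pos_of_pos hy _)
  obtain ⟨C, hC⟩ : ∃ C, ∑ y, g y ^ (1 + ρ) = Real.exp (-(ρ * C)) := by
    refine ⟨-Real.log (∑ y, g y ^ (1 + ρ)) / ρ, ?_⟩
    rw [mul_div_cancel₀ _ hρ.ne', neg_neg, Real.exp_log hγ]
  have hub : C ∈ upperBounds (W.cutoffAchievableFeedback ρ) := fun R hR =>
    W.le_of_mem_cutoffAchievableFeedback hρ hg hC (fun x => by rw [← hC]; exact hopt x) hR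
  have hsub := W.cutoffAchievable_subset_feedback ρ
  have hlub : ∀ u ∈ upperBounds (W.cutoffAchievable ρ), C ≤ u := by
    intro u hu
    by_contra! huC
    -- Random coding requires a nonnegative rate; rate zero being achievable puts every rate above
    -- `u` in that range.
    have hu0 : 0 ≤ u := hu (W.zero_mem_cutoffAchievable ρ)
    obtain ⟨R, huR, hRC⟩ := exists_between huC
    exact huR.not_ge (hu (W.mem_cutoffAchievable_of_lt hρ hP hC (hu0.trans huR.le) hRC))
  exact ⟨C, ⟨fun R hR => hub (hsub hR), hlub⟩,
    ⟨hub, fun u hu => hlub u fun R hR => hu (hsub hR)⟩⟩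

end DMC

theorem corollary1 {X Y : Type*} [Fintype X] [Nonempty X] [Fintype Y] (W : DMC X Y)
    (ρ : ℝ) (hρ : 0 < ρ) :
    IsLUB (W.cutoffAchievable ρ) (W.cutoffRate ρ) ∧
    IsLUB (W.cutoffAchievableFeedback ρ) (W.cutoffRateFeedback ρ) ∧
    W.cutoffRateFeedback ρ = W.cutoffRate ρ := by
  obtain ⟨C, h1, h2⟩ := W.exists_isLUB_cutoffAchievable hρ
  have hne : (W.cutoffAchievable ρ).Nonempty := ⟨0, W.zero_mem_cutoffAchievable ρ⟩
  have e1 : W.cutoffRate ρ = C := h1.csSup_eq hne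
  have e2 : W.cutoffRateFeedback ρ = C :=
    h2.csSup_eq (hne.mono (W.cutoffAchievable_subset_feedback ρ))
  rw [e1, e2]
  exact ⟨h1, h2, rfl⟩
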